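/- Let $\alpha>0$ and let $\mathcal F^2_\alpha$ be the Fock space of entire functions $f$ with $\|f\|^2=\frac{\alpha}{\pi}\int_{\mathbb C}|f(z)|^2e^{-\alpha|z|^2}\,dm(z)<\infty$, with inner product $\langle f,g\rangle=\frac{\alpha}{\pi}\int_{\mathbb C}f(z)\overline{g(z)}e^{-\alpha|z|^2}\,dm(z)$, where $m$ is planar Lebesgue measure. Put $e_k(z)=\frac{\sqrt{\alpha^k}}{\sqrt{k!}}z^k$ for $k\ge 0$ and $T_wf(\zeta)=e^{\alpha\bar w\zeta-\frac{\alpha}{2}|w|^2}f(\zeta-w)$ for $w\in\mathbb C$. Let $X=\{(\lambda,m_\lambda)\}_{\lambda\in\Lambda}$ be a divisor, i.e. a family $\Lambda$ of points of $\mathbb C$ with multiplicities $m_\lambda\in\mathbb N$. The divisor $X$ is called sampling for $\mathcal F^2_\alpha$ if there are constants $A,B>0$ such that $$A\|f\|^2\le\sum_{\lambda\in\Lambda}\sum_{k=0}^{m_\lambda-1}|\langle f,T_\lambda e_k\rangle|^2\le B\|f\|^2\qquad\text{for all } f\in\mathcal F^2_\alpha,$$ and interpolating for $\mathcal F^2_\alpha$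 if for every array $v=\{v_\lambda^{(k)}\}_{\lambda\in\Lambda,\,0\le k<m_\lambda}$ of complex numbers with $\sum_{\lambda\in\Lambda}\sum_{k=0}^{m_\lambda-1}|v_\lambda^{(k)}|^2<\infty$ there is $f\in\mathcal F^2_\alpha$ with $\langle f,T_\lambda e_k\rangle=v_\lambda^{(k)}$ for all $\lambda\in\Lambda$ and $0\le k<m_\lambda$. Suppose that $m_\lambda\to\infty$ as $|\lambda|\to\infty$, that is, for every $M$ there is $R$ such that $m_\lambda\ge M$ for all $\lambda\in\Lambda$ with $|\lambda|\ge R$. Then $X$ is not simultaneously sampling and interpolating for $\mathcal F^2_\alpha$. -/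

import Mathlib

noncomputable section

namespace Fock

open MeasureTheory ComplexConjugate

/-- The classical Fock space `F²_α`: entire functions `f` for which `|f(z)|² e^{-α|z|²}` is
integrable with respect to the Lebesgue measure of the plane. -/
def space (α : ℝ) : Set (ℂ → ℂ) :=
  {f | Differentiable ℂ f ∧ Integrable (fun z : ℂ => ‖f z‖ ^ 2 * Real.exp (-α * ‖z‖ ^ 2))}

/-- The squared norm `‖f‖² = (α/π) ∫ |f(z)|² e^{-α|z|²} dm(z)`. -/
def normSq (α : ℝ) (f : ℂ → ℂ) : ℝ :=
  α / Real.pi * ∫ z : ℂ, ‖f z‖ ^ 2 * Real.exp (-α * ‖z‖ ^ 2)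

/-- The inner product `⟨f, g⟩ = (α/π) ∫ f(z) conj(g(z)) e^{-α|z|²} dm(z)`. -/
def innerProd (α : ℝ) (f g : ℂ → ℂ) : ℂ :=
  ((α / Real.pi : ℝ) : ℂ) *
    ∫ z : ℂ, f z * conj (g z) * ((Real.exp (-α * ‖z‖ ^ 2) : ℝ) : ℂ)

/-- The orthonormal basis `e_k(z) = √(α^k) / √(k!) · z^k`. -/
def basisFun (α : ℝ) (k : ℕ) : ℂ → ℂ := fun z =>
  ((Real.sqrt (α ^ k) / Real.sqrt (k.factorial : ℝ) : ℝ) : ℂ) * z ^ k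

/-- The translation `T_w f(ζ) = e^{α conj(w) ζ - (α/2)|w|²} f(ζ - w)`. -/
def translate (α : ℝ) (w : ℂ) (f : ℂ → ℂ) : ℂ → ℂ := fun ζ =>
  Complex.exp ((α : ℂ) * conj w * ζ - (α : ℂ) / 2 * ((‖w‖ ^ 2 : ℝ) : ℂ)) * f (ζ - w)

/-- The divisor `{(pt i, m i)}` is sampling for `F²_α`:
`‖f‖² ≍ ∑_i ∑_{k < m i} |⟨f, T_{pt i} e_k⟩|²` for all `f` in the space, where the convergence
of the sum is part of the upper bound. -/
def IsSampling {ι : Type*} (α : ℝ) (pt : ι → ℂ) (m : ι → ℕ) : Prop :=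
  ∃ A B : ℝ, 0 < A ∧ 0 < B ∧ ∀ f ∈ space α,
    Summable (fun i => ∑ k ∈ Finset.range (m i),
      ‖innerProd α f (translate α (pt i) (basisFun α k))‖ ^ 2) ∧
    A * normSq α f ≤ ∑' i, ∑ k ∈ Finset.range (m i),
      ‖innerProd α f (translate α (pt i) (basisFun α k))‖ ^ 2 ∧
    ∑' i, ∑ k ∈ Finset.range (m i),
      ‖innerProd α f (translate α (pt i) (basisFun α k))‖ ^ 2 ≤ B * normSq α f

/-- The divisor `{(pt i, m i)}` is interpolating for `F²_α`: every square-summable array of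
data `v i k` (`k < m i`; the other values of `v` are irrelevant) is the array of coefficients
`⟨f, T_{pt i} e_k⟩` of some `f` in the space. -/
def IsInterpolating {ι : Type*} (α : ℝ) (pt : ι → ℂ) (m : ι → ℕ) : Prop :=
  ∀ v : ι → ℕ → ℂ, Summable (fun i => ∑ k ∈ Finset.range (m i), ‖v i k‖ ^ 2) →
    ∃ f ∈ space α, ∀ i, ∀ k < m i,
      innerProd α f (translate α (pt i) (basisFun α k)) = v i k

end Fock

end

/-! Both properties are tested on the normalized kernels `translate α w (basisFun α 0)`. The squared
coefficients of such a kernel at a node l are the masses of a Poisson law of mean α|w - l|², so the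
block of l contributes `poissonLT (m l)` of that mean: nearly 1 well inside the disc of radius
√(m/α) about l, and Gaussian-small well outside.

Sampling forces these discs, enlarged by a constant, to cover the plane (`IsSampling.exists_cover`).
Sampling and interpolation together force the discs, shrunk by a constant, to be disjoint
(`IsSampling.exists_separation`). When the radii tend to infinity this is impossible
(`false_of_cover_of_separated`): a circle just outside one large disc is connected and covered by
other slightly enlarged large discs, no single one of which contains it, so some point is close to
three disjoint large discs. Such discs leave a gap too wide for that (`false_of_three_discs`). -/

noncomputable section

namespace Fock

open MeasureTheory ComplexConjugate

/-! ### Gaussian integrals, translations and the embedding into L². -/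

/-- The mean value property against a radial weight. -/
theorem integral_mul_radial {h : ℂ → ℂ} (hh : Differentiable ℂ h) {φ : ℝ → ℝ} (hφ : Continuous φ)
    (hint : Integrable (fun z : ℂ => h z * (φ ‖z‖ : ℂ))) :
    ∫ z : ℂ, h z * (φ ‖z‖ : ℂ) = ∫ z : ℂ, h 0 * (φ ‖z‖ : ℂ) := by
  set G : ℂ → ℂ := fun z => h z * (φ ‖z‖ : ℂ) with hG
  have hGc : Continuous G := by
    have := hh.continuous
    fun_prop
  have hrot : ∀ θ : ℝ, MeasurePreserving (fun z : ℂ => circleMap 0 1 θ * z) := by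
    intro θ
    have := (rotation (Circle.exp θ)).measurePreserving
    convert this using 1
    ext z
    simp [circleMap, rotation_apply]
  have hemb : ∀ θ : ℝ, MeasurableEmbedding (fun z : ℂ => circleMap 0 1 θ * z) := fun θ =>
    (Homeomorph.mulLeft₀ (circleMap 0 1 θ)
      (circleMap_ne_center one_ne_zero)).measurableEmbedding
  have hint' : ∀ θ : ℝ, Integrable (fun z : ℂ => G (circleMap 0 1 θ * z)) := fun θ =>
    ((hrot θ).integrable_comp_emb (hemb θ)).2 hint
  have hI : ∀ θ : ℝ, ∫ z : ℂ, G (circleMap 0 1 θ * z) = ∫ z, G z := fun θ =>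
    (hrot θ).integral_comp (hemb θ) G
  have hprod : Integrable (Function.uncurry fun (θ : ℝ) (z : ℂ) => G (circleMap 0 1 θ * z))
      ((volume.restrict (Set.Ioc 0 (2 * Real.pi))).prod volume) := by
    have hc : Continuous (Function.uncurry fun (θ : ℝ) (z : ℂ) => G (circleMap 0 1 θ * z)) := by
      have := continuous_circleMap 0 1
      fun_prop
    refine (integrable_prod_iff hc.aestronglyMeasurable).2 ⟨.of_forall fun θ => hint' θ, ?_⟩
    have : ∀ θ : ℝ, ∫ z : ℂ, ‖G (circleMap 0 1 θ * z)‖ = ∫ z, ‖G z‖ := fun θ =>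
      (hrot θ).integral_comp (hemb θ) (fun z => ‖G z‖)
    simp only [Function.uncurry_apply_pair, this]
    exact integrable_const _
  -- Averaging over rotations: in one order every inner integral is the integral of G, in the other
  -- it is a circle mean of h, namely h(0).
  have hswap := integral_integral_swap hprod
  have hinner : ∀ z : ℂ, ∫ θ in Set.Ioc 0 (2 * Real.pi), G (circleMap 0 1 θ * z)
      = (2 * Real.pi : ℝ) * (h 0 * (φ ‖z‖ : ℂ)) := by
    intro z
    have hd : Differentiable ℂ (fun ζ : ℂ => h (ζ * z)) := by fun_prop
    have hav := (hd.diffContOnCl (s := Metric.ball 0 |1|)).circleAverage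
    rw [Real.circleAverage, intervalIntegral.integral_of_le Real.two_pi_pos.le] at hav
    simp only [zero_mul] at hav
    have hpt : ∀ θ : ℝ, G (circleMap 0 1 θ * z) = h (circleMap 0 1 θ * z) * (φ ‖z‖ : ℂ) := by
      intro θ
      simp [hG]
    simp only [hpt]
    rw [integral_mul_const, ← hav, Complex.real_smul]
    have : ((2 * Real.pi : ℝ) : ℂ) ≠ 0 := by exact_mod_cast Real.two_pi_pos.ne'
    rw [Complex.ofReal_inv, mul_assoc, mul_inv_cancel_left₀ this]
  simp only [hI, hinner] at hswap
  rw [integral_const, integral_const_mul, Complex.real_smul] at hswap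
  have h2 : (volume.restrict (Set.Ioc 0 (2 * Real.pi))).real Set.univ = 2 * Real.pi := by
    simp [Measure.real, Real.pi_pos.le]
  rw [h2] at hswap
  exact mul_left_cancel₀ (by exact_mod_cast Real.two_pi_pos.ne') hswap

theorem integral_norm_pow_mul_gaussian {α : ℝ} (hα : 0 < α) (k : ℕ) :
    ∫ z : ℂ, (‖z‖ ^ 2) ^ k * Real.exp (-α * ‖z‖ ^ 2) = Real.pi / α * (k.factorial / α ^ k) := by
  have h := Complex.integral_rpow_mul_exp_neg_mul_rpow (p := 2) (q := 2 * k) (b := α) (by norm_num)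
    (by have := k.cast_nonneg (α := ℝ); linarith) hα
  have e1 : ((2 * (k : ℝ) + 2) / 2) = k + 1 := by ring
  have e2 : (-(2 * (k : ℝ) + 2) / 2) = -((k + 1 : ℕ) : ℝ) := by push_cast; ring
  rw [e1, e2, Real.Gamma_nat_eq_factorial, Real.rpow_neg hα.le, Real.rpow_natCast] at h
  have e3 : ∀ z : ℂ, ‖z‖ ^ (2 * (k : ℝ)) * Real.exp (-α * ‖z‖ ^ (2 : ℝ))
      = (‖z‖ ^ 2) ^ k * Real.exp (-α * ‖z‖ ^ 2) := by
    intro z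
    rw [← pow_mul, ← Real.rpow_natCast ‖z‖ (2 * k), ← Real.rpow_natCast ‖z‖ 2]
    push_cast
    rfl
  simp only [e3] at h
  rw [h, pow_succ]
  field_simp

theorem integrable_norm_pow_mul_gaussian {α : ℝ} (hα : 0 < α) (k : ℕ) :
    Integrable (fun z : ℂ => (‖z‖ ^ 2) ^ k * Real.exp (-α * ‖z‖ ^ 2)) := by
  apply Integrable.of_integral_ne_zero
  rw [integral_norm_pow_mul_gaussian hα]
  positivity

theorem basisFun_mem_space {α : ℝ} (hα : 0 < α) (k : ℕ) : basisFun α k ∈ space α := by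
  refine ⟨by unfold basisFun; fun_prop, ?_⟩
  refine ((integrable_norm_pow_mul_gaussian hα k).const_mul
    ((Real.sqrt (α ^ k) / Real.sqrt (k.factorial : ℝ)) ^ 2)).congr (.of_forall fun z => ?_)
  simp only [basisFun, norm_mul, norm_pow, Complex.norm_real, Real.norm_eq_abs, mul_pow, sq_abs]
  ring

theorem norm_sq_eq (z : ℂ) : ((‖z‖ ^ 2 : ℝ) : ℂ) = z * conj z := by
  rw [← Complex.normSq_eq_norm_sq, Complex.normSq_eq_conj_mul_self, mul_comm]

theorem translate_mul_conj_translate (α : ℝ) (w : ℂ) (f g : ℂ → ℂ) (z : ℂ) :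
    translate α w f z * conj (translate α w g z) * ((Real.exp (-α * ‖z‖ ^ 2) : ℝ) : ℂ)
      = f (z - w) * conj (g (z - w)) * ((Real.exp (-α * ‖z - w‖ ^ 2) : ℝ) : ℂ) := by
  simp only [translate, map_mul, ← Complex.exp_conj, map_sub, Complex.conj_ofReal, map_div₀,
    Complex.conj_conj, map_ofNat, Complex.ofReal_exp, Complex.ofReal_mul, Complex.ofReal_neg,
    norm_sq_eq]
  rw [show ∀ a b c d e : ℂ, a * b * (c * d) * e = b * d * (a * c * e) by intros; ring,
    ← Complex.exp_add, ← Complex.exp_add]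
  congr 2
  ring

theorem innerProd_translate (α : ℝ) (w : ℂ) (f g : ℂ → ℂ) :
    innerProd α (translate α w f) (translate α w g) = innerProd α f g := by
  unfold innerProd
  simp only [translate_mul_conj_translate]
  rw [integral_sub_right_eq_self
    (fun z => f z * conj (g z) * ((Real.exp (-α * ‖z‖ ^ 2) : ℝ) : ℂ)) w]

theorem norm_translate_sq (α : ℝ) (w : ℂ) (f : ℂ → ℂ) (z : ℂ) :
    ‖translate α w f z‖ ^ 2 * Real.exp (-α * ‖z‖ ^ 2)
      = ‖f (z - w)‖ ^ 2 * Real.exp (-α * ‖z - w‖ ^ 2) := by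
  have h := translate_mul_conj_translate α w f f z
  rw [← norm_sq_eq, ← norm_sq_eq] at h
  exact_mod_cast h

theorem translate_mem_space {α : ℝ} (w : ℂ) {f : ℂ → ℂ} (hf : f ∈ space α) :
    translate α w f ∈ space α := by
  refine ⟨?_, ?_⟩
  · have := hf.1
    unfold translate
    fun_prop
  · simp only [norm_translate_sq]
    exact hf.2.comp_sub_right w

/-- The isometric image of a function of the Fock space in unweighted `L²`. -/
def gaussWeight (α : ℝ) (f : ℂ → ℂ) : ℂ → ℂ := fun z =>
  f z * ((Real.sqrt (α / Real.pi) * Real.exp (-α / 2 * ‖z‖ ^ 2) : ℝ) : ℂ)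

theorem gaussWeight_mul_conj {α : ℝ} (hα : 0 < α) (f g : ℂ → ℂ) (z : ℂ) :
    gaussWeight α f z * conj (gaussWeight α g z)
      = ((α / Real.pi : ℝ) : ℂ) * (f z * conj (g z) * ((Real.exp (-α * ‖z‖ ^ 2) : ℝ) : ℂ)) := by
  have h : (Real.sqrt (α / Real.pi) * Real.exp (-α / 2 * ‖z‖ ^ 2)) *
      (Real.sqrt (α / Real.pi) * Real.exp (-α / 2 * ‖z‖ ^ 2))
      = α / Real.pi * Real.exp (-α * ‖z‖ ^ 2) := by
    rw [mul_mul_mul_comm, Real.mul_self_sqrt (by positivity), ← Real.exp_add]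
    congr 2
    ring
  simp only [gaussWeight, map_mul, Complex.conj_ofReal]
  rw [mul_mul_mul_comm, ← Complex.ofReal_mul, h, Complex.ofReal_mul]
  ring

theorem norm_gaussWeight_sq {α : ℝ} (hα : 0 < α) (f : ℂ → ℂ) (z : ℂ) :
    ‖gaussWeight α f z‖ ^ 2 = α / Real.pi * (‖f z‖ ^ 2 * Real.exp (-α * ‖z‖ ^ 2)) := by
  have h := gaussWeight_mul_conj hα f f z
  rw [← norm_sq_eq, ← norm_sq_eq] at h
  exact_mod_cast h

theorem memLp_gaussWeight {α : ℝ} (hα : 0 < α) {f : ℂ → ℂ} (hf : f ∈ space α) :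
    MemLp (gaussWeight α f) 2 := by
  have hc : Continuous (gaussWeight α f) := by
    have := hf.1.continuous
    unfold gaussWeight
    fun_prop
  rw [memLp_two_iff_integrable_sq_norm hc.aestronglyMeasurable]
  simp only [norm_gaussWeight_sq hα]
  exact hf.2.const_mul _

/-- The embedding of the Fock space into `L²`. -/
def toL2 {α : ℝ} (hα : 0 < α) {f : ℂ → ℂ} (hf : f ∈ space α) : Lp ℂ 2 (volume : Measure ℂ) :=
  (memLp_gaussWeight hα hf).toLp _

theorem inner_toL2 {α : ℝ} (hα : 0 < α) {f g : ℂ → ℂ} (hf : f ∈ space α) (hg : g ∈ space α) :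
    inner ℂ (toL2 hα hg) (toL2 hα hf) = innerProd α f g := by
  rw [L2.inner_def, innerProd, ← integral_const_mul]
  refine integral_congr_ae ?_
  filter_upwards [(memLp_gaussWeight hα hf).coeFn_toLp, (memLp_gaussWeight hα hg).coeFn_toLp]
    with z h1 h2
  rw [toL2, toL2, h1, h2, ← gaussWeight_mul_conj hα]
  simp [RCLike.inner_apply]

theorem norm_toL2_sq {α : ℝ} (hα : 0 < α) {f : ℂ → ℂ} (hf : f ∈ space α) :
    ‖toL2 hα hf‖ ^ 2 = normSq α f := by
  have h := inner_toL2 hα hf hf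
  rw [inner_self_eq_norm_sq_to_K] at h
  have h2 : innerProd α f f = (normSq α f : ℂ) := by
    simp only [innerProd, normSq, ← norm_sq_eq]
    rw [Complex.ofReal_mul, ← integral_complex_ofReal]
    push_cast
    rfl
  rw [h2] at h
  apply Complex.ofReal_injective
  simpa using h

theorem integrable_mul_conj {α : ℝ} (hα : 0 < α) {f g : ℂ → ℂ} (hf : f ∈ space α)
    (hg : g ∈ space α) :
    Integrable (fun z => f z * conj (g z) * ((Real.exp (-α * ‖z‖ ^ 2) : ℝ) : ℂ)) := by
  have h := (memLp_gaussWeight hα hg).star.integrable_mul (memLp_gaussWeight hα hf)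
  have hne : ((α / Real.pi : ℝ) : ℂ) ≠ 0 := by
    exact_mod_cast (div_pos hα Real.pi_pos).ne'
  refine (h.const_mul ((α / Real.pi : ℝ) : ℂ)⁻¹).congr (.of_forall fun z => ?_)
  have := gaussWeight_mul_conj hα f g z
  simp only [Pi.mul_apply, Pi.star_apply, RCLike.star_def]
  rw [mul_comm (conj _), this, inv_mul_cancel_left₀ hne]

theorem innerProd_basisFun {α : ℝ} (hα : 0 < α) (j k : ℕ) :
    innerProd α (basisFun α j) (basisFun α k) = if j = k then 1 else 0 := by
  -- For j = k + d the integrand is z^d times a radial weight, so only the value of z^d at 0 counts.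
  -- The case j < k follows by conjugate symmetry.
  have key : ∀ d k : ℕ, innerProd α (basisFun α (k + d)) (basisFun α k)
      = if d = 0 then 1 else 0 := by
    intro d k
    set c : ℕ → ℂ := fun k => ((Real.sqrt (α ^ k) / Real.sqrt (k.factorial : ℝ) : ℝ) : ℂ) with hc
    have hfun : ∀ z : ℂ, basisFun α (k + d) z * conj (basisFun α k z) *
        ((Real.exp (-α * ‖z‖ ^ 2) : ℝ) : ℂ)
        = (c (k + d) * c k * z ^ d) * (((‖z‖ ^ 2) ^ k * Real.exp (-α * ‖z‖ ^ 2) : ℝ) : ℂ) := by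
      intro z
      simp only [basisFun, map_mul, Complex.conj_ofReal, map_pow, hc]
      rw [Complex.ofReal_mul ((‖z‖ ^ 2) ^ k), Complex.ofReal_pow (‖z‖ ^ 2), norm_sq_eq]
      ring
    have hint := integrable_mul_conj hα (basisFun_mem_space hα (k + d)) (basisFun_mem_space hα k)
    rw [innerProd]
    simp only [hfun] at hint ⊢
    have := integral_mul_radial (h := fun z => c (k + d) * c k * z ^ d) (by fun_prop)
      (φ := fun r => (r ^ 2) ^ k * Real.exp (-α * r ^ 2)) (by fun_prop) hint
    rw [this, integral_const_mul, integral_complex_ofReal, integral_norm_pow_mul_gaussian hα]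
    split_ifs with hd
    · subst hd
      simp only [hc, add_zero, pow_zero, mul_one]
      norm_cast
      rw [div_mul_div_comm, Real.mul_self_sqrt (by positivity), Real.mul_self_sqrt (by positivity)]
      have := Real.pi_pos
      field_simp
    · simp [hd]
  rcases le_total k j with h | h
  · obtain ⟨d, rfl⟩ := Nat.exists_eq_add_of_le h
    rw [key]
    simp
  · obtain ⟨d, rfl⟩ := Nat.exists_eq_add_of_le h
    rw [← inner_toL2 hα (basisFun_mem_space hα _) (basisFun_mem_space hα _), ← inner_conj_symm,
      inner_toL2, key]
    by_cases hd : d = 0 <;> simp [hd]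

/-- The reproducing property of the normalized kernel `T_w 1`. -/
theorem innerProd_translate_basisFun_zero {α : ℝ} (hα : 0 < α) {f : ℂ → ℂ} (hf : f ∈ space α)
    (w : ℂ) :
    innerProd α f (translate α w (basisFun α 0))
      = Complex.exp (-((α : ℂ) / 2 * ((‖w‖ ^ 2 : ℝ) : ℂ))) * f w := by
  -- After recentring at w, the cross term of the Gaussian cancels the antiholomorphic part of the
  -- conjugated kernel, leaving this entire function times a radial weight.
  set h : ℂ → ℂ := fun z =>
    f (z + w) * Complex.exp (-((α : ℂ) * conj w * z) - (α : ℂ) / 2 * ((‖w‖ ^ 2 : ℝ) : ℂ)) with hh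
  have hshift : ∀ z : ℂ, f (z + w) * conj (translate α w (basisFun α 0) (z + w)) *
      ((Real.exp (-α * ‖z + w‖ ^ 2) : ℝ) : ℂ) = h z * ((Real.exp (-α * ‖z‖ ^ 2) : ℝ) : ℂ) := by
    intro z
    simp only [translate, basisFun, hh, map_mul, ← Complex.exp_conj, map_sub, Complex.conj_ofReal,
      map_div₀, Complex.conj_conj, map_ofNat, Complex.ofReal_exp, Complex.ofReal_mul,
      Complex.ofReal_neg, norm_sq_eq, pow_zero, Nat.factorial_zero, Nat.cast_one,
      Real.sqrt_one, div_one, Complex.ofReal_one, mul_one, mul_assoc, ← Complex.exp_add]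
    congr 2
    simp only [map_add]
    ring
  have hint := (integrable_mul_conj hα hf
    (translate_mem_space w (basisFun_mem_space hα 0))).comp_add_right w
  simp only [hshift] at hint
  have hd : Differentiable ℂ h := by
    have := hf.1
    fun_prop
  have hmv := integral_mul_radial hd (φ := fun r => Real.exp (-α * r ^ 2)) (by fun_prop) hint
  rw [innerProd, ← integral_add_right_eq_self _ w]
  simp only [hshift]
  rw [hmv, integral_const_mul, integral_complex_ofReal]
  have hg := integral_norm_pow_mul_gaussian hα 0
  simp only [pow_zero, one_mul, Nat.factorial_zero, Nat.cast_one, div_one, mul_one] at hg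
  have hc : ((α / Real.pi : ℝ) : ℂ) * ((Real.pi / α : ℝ) : ℂ) = 1 := by
    norm_cast
    have := Real.pi_pos
    field_simp
  rw [hg, mul_left_comm, hc]
  simp [hh, mul_comm]

/-! ### Poisson tails and the coefficients of kernels. -/

/-- From u/v ≤ exp((u - v)/v), the ratio (u/v)^(2k) is at most exp(2k(u - v)/v) ≤ exp(2v(u - v));
then complete the square. The hypothesis is a product with u - v so that it serves both tails: k ≤
v² with u ≥ v, and k ≥ v² with u ≤ v. -/
theorem exp_neg_sq_mul_pow_le {u v : ℝ} (hu : 0 ≤ u) (hv : 0 < v) {k : ℕ}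
    (h : k * (u - v) ≤ v ^ 2 * (u - v)) :
    Real.exp (-u ^ 2) * (u ^ 2) ^ k
      ≤ Real.exp (-(u - v) ^ 2) * (Real.exp (-v ^ 2) * (v ^ 2) ^ k) := by
  have h1 : u ≤ v * Real.exp ((u - v) / v) := by
    have := mul_le_mul_of_nonneg_left (Real.add_one_le_exp ((u - v) / v)) hv.le
    have e : v * ((u - v) / v + 1) = u := by field_simp; ring
    linarith
  have h2 : (u ^ 2) ^ k ≤ (v ^ 2) ^ k * Real.exp (2 * (k * (u - v)) / v) := by
    calc (u ^ 2) ^ k ≤ ((v * Real.exp ((u - v) / v)) ^ 2) ^ k := by gcongr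
      _ = _ := by
        rw [mul_pow, mul_pow, ← Real.exp_nat_mul, ← Real.exp_nat_mul]
        congr 2
        push_cast
        ring
  calc Real.exp (-u ^ 2) * (u ^ 2) ^ k
      ≤ Real.exp (-u ^ 2) * ((v ^ 2) ^ k * Real.exp (2 * (k * (u - v)) / v)) := by gcongr
    _ = Real.exp (-u ^ 2 + 2 * (k * (u - v)) / v) * (v ^ 2) ^ k := by rw [Real.exp_add]; ring
    _ ≤ Real.exp (-(u - v) ^ 2 + -v ^ 2) * (v ^ 2) ^ k := by
        refine mul_le_mul_of_nonneg_right (Real.exp_le_exp.2 ?_) (by positivity)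
        have : 2 * (k * (u - v)) / v ≤ 2 * (v ^ 2 * (u - v)) / v := by gcongr
        have e : 2 * (v ^ 2 * (u - v)) / v = 2 * v * (u - v) := by field_simp
        rw [e] at this
        linarith
    _ = _ := by rw [Real.exp_add]; ring

/-- The probability that a Poisson variable of mean `x` is less than `m`. -/
def poissonLT (m : ℕ) (x : ℝ) : ℝ :=
  ∑ k ∈ Finset.range m, Real.exp (-x) * (x ^ k / k.factorial)

theorem poissonLT_le_one (m : ℕ) {x : ℝ} (hx : 0 ≤ x) : poissonLT m x ≤ 1 := by
  rw [poissonLT, ← Finset.mul_sum]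
  calc _ ≤ Real.exp (-x) * Real.exp x := by
        gcongr
        exact Real.sum_le_exp_of_nonneg hx m
    _ = 1 := by rw [← Real.exp_add]; simp

theorem poissonLT_sq_le {m : ℕ} {u v : ℝ} (hv : 0 < v) (huv : v ≤ u) (hm : (m : ℝ) ≤ v ^ 2) :
    poissonLT m (u ^ 2) ≤ Real.exp (-(u - v) ^ 2) * poissonLT m (v ^ 2) := by
  rw [poissonLT, poissonLT, Finset.mul_sum]
  refine Finset.sum_le_sum fun k hk => ?_
  have hk' : (k : ℝ) ≤ v ^ 2 :=
    (Nat.cast_le.2 (Finset.mem_range.1 hk).le).trans hm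
  have := exp_neg_sq_mul_pow_le (hv.le.trans huv) hv (k := k)
    (mul_le_mul_of_nonneg_right hk' (sub_nonneg.2 huv))
  rw [← mul_div_assoc, ← mul_div_assoc, ← mul_div_assoc]
  gcongr

theorem hasSum_poisson (x : ℝ) :
    HasSum (fun k : ℕ => Real.exp (-x) * (x ^ k / k.factorial)) 1 := by
  have h := (NormedSpace.expSeries_div_hasSum_exp x).mul_left (Real.exp (-x))
  rwa [← Real.exp_eq_exp_ℝ, ← Real.exp_add, neg_add_cancel, Real.exp_zero] at h

theorem one_sub_poissonLT_sq_le {m : ℕ} {u v : ℝ} (hu : 0 ≤ u) (hv : 0 < v) (huv : u ≤ v)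
    (hm : v ^ 2 ≤ m) : 1 - poissonLT m (u ^ 2) ≤ Real.exp (-(u - v) ^ 2) := by
  have hs : ∀ x : ℝ, HasSum (fun k : ℕ => Real.exp (-x) * (x ^ (k + m) / (k + m).factorial))
      (1 - poissonLT m x) := fun x =>
    (hasSum_nat_add_iff' (f := fun k : ℕ => Real.exp (-x) * (x ^ k / k.factorial)) m).2
      (hasSum_poisson x)
  have h := hasSum_le (fun k => ?_) (hs (u ^ 2))
    ((hs (v ^ 2)).mul_left (Real.exp (-(u - v) ^ 2)))
  · refine h.trans ?_
    have h0 : 0 ≤ poissonLT m (v ^ 2) := Finset.sum_nonneg fun k _ => by positivity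
    exact mul_le_of_le_one_right (Real.exp_pos _).le (by linarith)
  · have hk' : v ^ 2 ≤ ((k + m : ℕ) : ℝ) := hm.trans (Nat.cast_le.2 (Nat.le_add_left _ _))
    have := exp_neg_sq_mul_pow_le hu hv (k := k + m)
      (mul_le_mul_of_nonpos_right hk' (sub_nonpos.2 huv))
    rw [← mul_div_assoc, ← mul_div_assoc, ← mul_div_assoc]
    gcongr

/-- With the two arguments exchanged, the reproducing property evaluates the translated basis
function at w. -/
theorem norm_innerProd_translate_sq {α : ℝ} (hα : 0 < α) (w l : ℂ) (k : ℕ) :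
    ‖innerProd α (translate α w (basisFun α 0)) (translate α l (basisFun α k))‖ ^ 2
      = Real.exp (-(α * ‖w - l‖ ^ 2)) * ((α * ‖w - l‖ ^ 2) ^ k / k.factorial) := by
  have hw := translate_mem_space w (basisFun_mem_space hα 0)
  have hl := translate_mem_space l (basisFun_mem_space hα k)
  rw [← inner_toL2 hα hw hl, norm_inner_symm, inner_toL2 hα hl hw,
    innerProd_translate_basisFun_zero hα hl, norm_mul, mul_pow, Complex.norm_exp,
    ← Real.exp_nat_mul]
  have h := norm_translate_sq α l (basisFun α k) w
  have e : ((2 : ℕ) : ℝ) * (-((α : ℂ) / 2 * ((‖w‖ ^ 2 : ℝ) : ℂ))).re = -α * ‖w‖ ^ 2 := by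
    have : (-((α : ℂ) / 2 * ((‖w‖ ^ 2 : ℝ) : ℂ))) = ((-(α / 2 * ‖w‖ ^ 2) : ℝ) : ℂ) := by
      push_cast
      ring
    rw [this, Complex.ofReal_re]
    push_cast
    ring
  rw [e, mul_comm, h, basisFun, norm_mul, Complex.norm_real, mul_pow, norm_pow, Real.norm_eq_abs,
    sq_abs, div_pow, Real.sq_sqrt (by positivity), Real.sq_sqrt (by positivity), neg_mul]
  ring

theorem sum_norm_innerProd_translate_sq {α : ℝ} (hα : 0 < α) (w l : ℂ) (m : ℕ) :
    ∑ k ∈ Finset.range m,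
      ‖innerProd α (translate α w (basisFun α 0)) (translate α l (basisFun α k))‖ ^ 2
      = poissonLT m ((Real.sqrt α * ‖w - l‖) ^ 2) := by
  rw [mul_pow, Real.sq_sqrt hα.le]
  exact Finset.sum_congr rfl fun k _ => norm_innerProd_translate_sq hα w l k

theorem normSq_translate_basisFun_zero {α : ℝ} (hα : 0 < α) (w : ℂ) :
    normSq α (translate α w (basisFun α 0)) = 1 := by
  have hw := translate_mem_space w (basisFun_mem_space hα 0)
  rw [← norm_toL2_sq hα hw]
  have h := inner_toL2 hα hw hw
  rw [innerProd_translate, innerProd_basisFun hα, inner_self_eq_norm_sq_to_K] at h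
  apply Complex.ofReal_injective
  simpa using h

theorem orthonormal_toL2_translate {α : ℝ} (hα : 0 < α) (l : ℂ) :
    Orthonormal ℂ (fun k : ℕ => toL2 hα (translate_mem_space l (basisFun_mem_space hα k))) := by
  rw [orthonormal_iff_ite]
  intro j k
  rw [inner_toL2, innerProd_translate, innerProd_basisFun hα]
  simp only [eq_comm]

/-- Cauchy–Schwarz for f minus its projection p. If f is nearly in the span, its pairing with g is
nearly determined by the first m coefficients. -/
theorem norm_inner_sub_sum_sq_le {E : Type*} [NormedAddCommGroup E] [InnerProductSpace ℂ E]
    {a : ℕ → E} (ha : Orthonormal ℂ a) (f g : E) (m : ℕ) :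
    ‖inner ℂ f g - ∑ k ∈ Finset.range m, conj (inner ℂ (a k) f) * inner ℂ (a k) g‖ ^ 2
      ≤ (‖f‖ ^ 2 - ∑ k ∈ Finset.range m, ‖inner ℂ (a k) f‖ ^ 2) * ‖g‖ ^ 2 := by
  set p := ∑ k ∈ Finset.range m, inner ℂ (a k) f • a k with hp
  have h1 : inner ℂ f g - ∑ k ∈ Finset.range m, conj (inner ℂ (a k) f) * inner ℂ (a k) g
      = inner ℂ (f - p) g := by
    rw [inner_sub_left, hp, sum_inner]
    simp only [inner_smul_left]
  have h2 : ‖f - p‖ ^ 2 = ‖f‖ ^ 2 - ∑ k ∈ Finset.range m, ‖inner ℂ (a k) f‖ ^ 2 := by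
    have hpp : ‖p‖ ^ 2 = ∑ k ∈ Finset.range m, ‖inner ℂ (a k) f‖ ^ 2 := by
      rw [← @inner_self_eq_norm_sq ℂ, hp, ha.inner_sum, map_sum]
      refine Finset.sum_congr rfl fun k _ => ?_
      rw [RCLike.conj_mul]
      norm_cast
    have hfp : RCLike.re (inner ℂ f p) = ∑ k ∈ Finset.range m, ‖inner ℂ (a k) f‖ ^ 2 := by
      rw [hp, inner_sum, map_sum]
      refine Finset.sum_congr rfl fun k _ => ?_
      rw [inner_smul_right, ← inner_conj_symm f, RCLike.mul_conj]
      norm_cast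
    rw [@norm_sub_sq ℂ, hfp, hpp]
    ring
  rw [h1, ← h2, ← mul_pow]
  gcongr
  exact norm_inner_le_norm _ _

/-! ### Plane geometry of large disjoint discs. -/

theorem false_of_three_discs {a₁ a₂ a₃ p : ℂ} {ρ₁ ρ₂ ρ₃ K c : ℝ} (hc : 0 < c) (hK : 7 * c ≤ K)
    (h₁ : K ≤ ρ₁) (h₂ : K ≤ ρ₂) (h₃ : K ≤ ρ₃)
    (h₁₂ : ρ₁ + ρ₂ ≤ ‖a₁ - a₂‖) (h₂₃ : ρ₂ + ρ₃ ≤ ‖a₂ - a₃‖) (h₁₃ : ρ₁ + ρ₃ ≤ ‖a₁ - a₃‖)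
    (hp₁ : ‖p - a₁‖ ≤ ρ₁ + c) (hp₂ : ‖p - a₂‖ ≤ ρ₂ + c) (hp₃ : ‖p - a₃‖ ≤ ρ₃ + c) : False := by
  -- Each disc is replaced by a disc of radius exactly K inside it, centred at p + u with u pointing
  -- towards a. The three new centres are then at least 2K apart.
  have shrink : ∀ (a : ℂ) (ρ : ℝ), K ≤ ρ → ‖p - a‖ ≤ ρ + c →
      ∃ u : ℂ, ‖u‖ ≤ K + c ∧ ‖p + u - a‖ ≤ ρ - K := by
    intro a ρ hρ hp
    have h0 : 0 < ρ + c := by linarith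
    have h1 : 0 ≤ (K + c) / (ρ + c) := div_nonneg (by linarith) h0.le
    refine ⟨(((K + c) / (ρ + c) : ℝ) : ℂ) * (a - p), ?_, ?_⟩
    · rw [norm_mul, Complex.norm_real, Real.norm_of_nonneg h1, norm_sub_rev]
      calc _ ≤ (K + c) / (ρ + c) * (ρ + c) := by gcongr
        _ = K + c := div_mul_cancel₀ _ h0.ne'
    · have e : p + (((K + c) / (ρ + c) : ℝ) : ℂ) * (a - p) - a
          = (((ρ - K) / (ρ + c) : ℝ) : ℂ) * (p - a) := by
        have : (ρ - K) / (ρ + c) = 1 - (K + c) / (ρ + c) := by field_simp; ring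
        rw [this]
        push_cast
        ring
      rw [e, norm_mul, Complex.norm_real,
        Real.norm_of_nonneg (div_nonneg (sub_nonneg.2 hρ) h0.le)]
      calc _ ≤ (ρ - K) / (ρ + c) * (ρ + c) := by
            have := div_nonneg (sub_nonneg.2 hρ) h0.le
            gcongr
        _ = ρ - K := div_mul_cancel₀ _ h0.ne'
  obtain ⟨u₁, hu₁, hd₁⟩ := shrink a₁ ρ₁ h₁ hp₁
  obtain ⟨u₂, hu₂, hd₂⟩ := shrink a₂ ρ₂ h₂ hp₂
  obtain ⟨u₃, hu₃, hd₃⟩ := shrink a₃ ρ₃ h₃ hp₃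
  have far : ∀ {a b u v : ℂ} {ρ σ : ℝ}, ρ + σ ≤ ‖a - b‖ → ‖p + u - a‖ ≤ ρ - K →
      ‖p + v - b‖ ≤ σ - K → 2 * K ≤ ‖u - v‖ := by
    intro a b u v ρ σ hab hu hv
    have : a - b = (u - v) - (p + u - a) + (p + v - b) := by ring
    have h1 := norm_add_le ((u - v) - (p + u - a)) (p + v - b)
    have h2 := norm_sub_le (u - v) (p + u - a)
    rw [← this] at h1
    linarith
  have hK0 : 0 ≤ 2 * K := by linarith
  have s₁₂ := pow_le_pow_left₀ hK0 (far h₁₂ hd₁ hd₂) 2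
  have s₂₃ := pow_le_pow_left₀ hK0 (far h₂₃ hd₂ hd₃) 2
  have s₁₃ := pow_le_pow_left₀ hK0 (far h₁₃ hd₁ hd₃) 2
  have t₁ := pow_le_pow_left₀ (norm_nonneg _) hu₁ 2
  have t₂ := pow_le_pow_left₀ (norm_nonneg _) hu₂ 2
  have t₃ := pow_le_pow_left₀ (norm_nonneg _) hu₃ 2
  simp only [Complex.sq_norm, Complex.normSq_apply, Complex.sub_re, Complex.sub_im]
    at s₁₂ s₂₃ s₁₃ t₁ t₂ t₃
  -- The squared pairwise distances sum to at most 3∑|uᵢ|², so 12K² ≤ 9(K + c)². This fails for K ≥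
  -- 7c since 9·8² < 12·7².
  nlinarith [sq_nonneg (u₁.re + u₂.re + u₃.re), sq_nonneg (u₁.im + u₂.im + u₃.im)]

/-- Otherwise the point dividing the segment from a to b in the ratio ρ : σ lies in both discs. -/
theorem add_le_norm_sub_of_disjoint {a b : ℂ} {ρ σ : ℝ} (hρ : 0 < ρ) (hσ : 0 < σ)
    (h : ∀ w : ℂ, ‖w - a‖ ≤ ρ → ‖w - b‖ ≤ σ → False) : ρ + σ ≤ ‖a - b‖ := by
  by_contra! hlt
  have hs : 0 < ρ + σ := by linarith
  refine h (a + ((ρ / (ρ + σ) : ℝ) : ℂ) * (b - a)) ?_ ?_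
  · rw [add_sub_cancel_left, norm_mul, Complex.norm_real, Real.norm_of_nonneg (by positivity),
      norm_sub_rev]
    calc _ ≤ ρ / (ρ + σ) * (ρ + σ) := by gcongr
      _ = ρ := div_mul_cancel₀ _ hs.ne'
  · have e : a + ((ρ / (ρ + σ) : ℝ) : ℂ) * (b - a) - b = ((σ / (ρ + σ) : ℝ) : ℂ) * (a - b) := by
      have : σ / (ρ + σ) = 1 - ρ / (ρ + σ) := by field_simp; ring
      rw [this]
      push_cast
      ring
    rw [e, norm_mul, Complex.norm_real, Real.norm_of_nonneg (by positivity)]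
    calc _ ≤ σ / (ρ + σ) * (ρ + σ) := by gcongr
      _ = σ := div_mul_cancel₀ _ hs.ne'

/-- Large disjoint discs whose enlargements by a constant cover the complement of a compact set
do not exist if all but boundedly many of the discs are arbitrarily large. -/
theorem false_of_cover_of_separated {ι : Type*} {pt : ι → ℂ} {ρ : ι → ℝ} {c : ℝ} (hc : 0 ≤ c)
    (hlarge : ∀ K : ℝ, ∃ R : ℝ, ∀ i, R ≤ ‖pt i‖ → K ≤ ρ i)
    (hcover : ∀ z : ℂ, ∃ i, ‖z - pt i‖ ≤ ρ i + c)
    (hsep : ∀ i j, i ≠ j → 0 < ρ i → 0 < ρ j → ρ i + ρ j ≤ ‖pt i - pt j‖) : False := by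
  -- Discs of radius below K have centres in a bounded set, so they cannot reach far points.
  have hcov : ∀ K : ℝ, ∃ R : ℝ, 0 ≤ R ∧ ∀ z : ℂ, R < ‖z‖ → ∃ i, K ≤ ρ i ∧
      ‖z - pt i‖ ≤ ρ i + c := by
    intro K
    obtain ⟨R, hR⟩ := hlarge K
    refine ⟨max 0 (R + K + c), le_max_left _ _, fun z hz => ?_⟩
    obtain ⟨i, hi⟩ := hcover z
    refine ⟨i, ?_, hi⟩
    by_contra! hlt
    have h1 : ‖pt i‖ < R := by
      by_contra! h
      exact absurd (hR i h) hlt.not_ge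
    have h2 := norm_le_norm_add_norm_sub' z (pt i)
    have h3 := (le_max_right _ _).trans_lt hz
    linarith
  have triple : ∀ {d K : ℝ}, 0 < d → 7 * d ≤ K → ∀ {i j k : ι} {p : ℂ}, i ≠ j → j ≠ k → i ≠ k →
      K ≤ ρ i → K ≤ ρ j → K ≤ ρ k → ‖p - pt i‖ ≤ ρ i + d → ‖p - pt j‖ ≤ ρ j + d →
      ‖p - pt k‖ ≤ ρ k + d → False := by
    intro d K hd hK i j k p hij hjk hik hi hj hk
    exact false_of_three_discs hd hK hi hj hk (hsep _ _ hij (by linarith) (by linarith))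
      (hsep _ _ hjk (by linarith) (by linarith)) (hsep _ _ hik (by linarith) (by linarith))
  set K : ℝ := 7 * (c + 1) with hK
  have hK0 : 0 < K := by positivity
  obtain ⟨R, hR0, hR⟩ := hcov K
  -- a disc whose boundary circle lies in the region covered by large discs
  obtain ⟨i, hiK, hi⟩ : ∃ i, K ≤ ρ i ∧ ρ i + (R + c + 1) < ‖pt i‖ := by
    set K' : ℝ := 7 * (R + c + 1) with hK'
    obtain ⟨R', hR'0, hR'⟩ := hcov K'
    have hfar : ∀ N : ℝ, ∃ i, K' ≤ ρ i ∧ N < ‖pt i‖ + ρ i := by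
      intro N
      set t : ℝ := max R' (N + c) + 1 with ht
      have ht0 : 0 ≤ t := by have := le_max_left R' (N + c); linarith
      have htn : ‖(t : ℂ)‖ = t := by rw [Complex.norm_real, Real.norm_of_nonneg ht0]
      obtain ⟨i, hi, hi'⟩ := hR' t (by rw [htn]; have := le_max_left R' (N + c); linarith)
      refine ⟨i, hi, ?_⟩
      have h2 := norm_le_norm_add_norm_sub' (t : ℂ) (pt i)
      rw [htn] at h2
      have := le_max_right R' (N + c)
      linarith
    obtain ⟨i₁, h₁, -⟩ := hfar 0
    obtain ⟨i₂, h₂, n₂⟩ := hfar (‖pt i₁‖ + ρ i₁)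
    obtain ⟨i₃, h₃, n₃⟩ := hfar (‖pt i₂‖ + ρ i₂)
    -- Otherwise every large disc comes within R + c + 1 of the origin, and three of them contradict
    -- `triple` there. Their increasing values of ‖pt‖ + ρ make them distinct.
    by_contra! hcon
    have near : ∀ i, K' ≤ ρ i → ‖(0 : ℂ) - pt i‖ ≤ ρ i + (R + c + 1) := fun i h => by
      rw [zero_sub, norm_neg]
      exact hcon i (by linarith)
    refine triple (by linarith) hK'.ge ?_ ?_ ?_ h₁ h₂ h₃ (near _ h₁) (near _ h₂) (near _ h₃)
    · rintro rfl; linarith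
    · rintro rfl; linarith
    · rintro rfl; linarith
  have hr0 : 0 < ρ i + c + 1 := by linarith
  -- The extra 1 keeps the circle out of the enlarged disc of i itself and makes the covering discs
  -- open.
  have hS : ∀ z ∈ Metric.sphere (pt i) (ρ i + c + 1), ∃ j, j ≠ i ∧ K ≤ ρ j ∧
      z ∈ Metric.ball (pt j) (ρ j + c + 1) := by
    intro z hz
    rw [mem_sphere_iff_norm] at hz
    have h2 := norm_le_norm_add_norm_sub' (pt i) z
    rw [norm_sub_rev] at h2
    obtain ⟨j, hj, hj'⟩ := hR z (by linarith)
    refine ⟨j, ?_, hj, ?_⟩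
    · rintro rfl
      linarith
    · rw [mem_ball_iff_norm]
      linarith
  obtain ⟨z₀, hz₀⟩ := (NormedSpace.sphere_nonempty (x := pt i)).2 hr0.le
  obtain ⟨j, hji, hj, hzj⟩ := hS z₀ hz₀
  have hpre := isPreconnected_sphere (E := ℂ) (by simp [Complex.rank_real_complex]) (pt i)
    (ρ i + c + 1)
  set V : Set ℂ := ⋃ k ∈ {k | k ≠ i ∧ k ≠ j ∧ K ≤ ρ k}, Metric.ball (pt k) (ρ k + c + 1) with hV
  have hVo : IsOpen V := isOpen_biUnion fun _ _ => Metric.isOpen_ball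
  have hcovS : Metric.sphere (pt i) (ρ i + c + 1) ⊆ Metric.ball (pt j) (ρ j + c + 1) ∪ V := by
    intro z hz
    obtain ⟨k, hki, hk, hzk⟩ := hS z hz
    by_cases hkj : k = j
    · exact Or.inl (hkj ▸ hzk)
    · exact Or.inr (Set.mem_biUnion (show k ∈ {k | k ≠ i ∧ k ≠ j ∧ K ≤ ρ k} from ⟨hki, hkj, hk⟩) hzk)
  -- The point of the circle diametrically away from `pt j`.
  have hout : ∃ q ∈ Metric.sphere (pt i) (ρ i + c + 1), q ∉ Metric.ball (pt j) (ρ j + c + 1) := by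
    have hd := hsep i j hji.symm (by linarith) (by linarith)
    have hd0 : 0 < ‖pt i - pt j‖ := by linarith
    have hd0' : ((‖pt i - pt j‖ : ℝ) : ℂ) ≠ 0 := by exact_mod_cast hd0.ne'
    refine ⟨pt i + (((ρ i + c + 1) / ‖pt i - pt j‖ : ℝ) : ℂ) * (pt i - pt j), ?_, ?_⟩
    · rw [mem_sphere_iff_norm, add_sub_cancel_left, norm_mul, Complex.norm_real,
        Real.norm_of_nonneg (by positivity), div_mul_cancel₀ _ hd0.ne']
    · rw [mem_ball_iff_norm, not_lt]
      have e : pt i + (((ρ i + c + 1) / ‖pt i - pt j‖ : ℝ) : ℂ) * (pt i - pt j) - pt j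
          = ((1 + (ρ i + c + 1) / ‖pt i - pt j‖ : ℝ) : ℂ) * (pt i - pt j) := by
        push_cast
        ring
      rw [e, norm_mul, Complex.norm_real, Real.norm_of_nonneg (by positivity), add_mul,
        div_mul_cancel₀ _ hd0.ne']
      linarith
  obtain ⟨q, hqS, hqj⟩ := hout
  obtain ⟨p, hpS, hpj, hpV⟩ := hpre _ _ Metric.isOpen_ball hVo hcovS ⟨z₀, hz₀, hzj⟩
    ⟨q, hqS, (hcovS hqS).resolve_left hqj⟩
  obtain ⟨k, ⟨hki, hkj, hk⟩, hpk⟩ := Set.mem_iUnion₂.1 hpV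
  rw [mem_ball_iff_norm] at hpj hpk
  rw [mem_sphere_iff_norm] at hpS
  exact triple (d := c + 1) (by linarith) hK.ge hji.symm hkj.symm hki.symm hiK hj hk
    (by linarith) (by linarith) (by linarith)

/-! ### Covering and separation from sampling and interpolation. -/

theorem poissonLT_scaled_le {α : ℝ} (hα : 0 < α) {m : ℕ} {d d' : ℝ} (h0 : 0 < d') (hd : d' ≤ d)
    (hm : Real.sqrt (m / α) ≤ d') :
    poissonLT m ((Real.sqrt α * d) ^ 2)
      ≤ Real.exp (-(α * (d - d') ^ 2)) * poissonLT m ((Real.sqrt α * d') ^ 2) := by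
  have hs : 0 < Real.sqrt α := Real.sqrt_pos.2 hα
  have hsq : Real.sqrt α ^ 2 = α := Real.sq_sqrt hα.le
  have h := poissonLT_sq_le (m := m) (u := Real.sqrt α * d) (v := Real.sqrt α * d') (by positivity)
    (by gcongr) (by
      rw [mul_pow, hsq, ← div_le_iff₀' hα]
      exact (Real.sqrt_le_left h0.le).1 hm)
  rwa [← mul_sub, mul_pow (Real.sqrt α) (d - d'), hsq] at h

theorem one_sub_poissonLT_scaled_le {α : ℝ} (hα : 0 < α) {m : ℕ} {d C : ℝ} (h0 : 0 ≤ d)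
    (hC : 0 < C) (hd : d ≤ Real.sqrt (m / α) - C) :
    1 - poissonLT m ((Real.sqrt α * d) ^ 2) ≤ Real.exp (-(α * C ^ 2)) := by
  have hs : 0 < Real.sqrt α := Real.sqrt_pos.2 hα
  have hsq : Real.sqrt α ^ 2 = α := Real.sq_sqrt hα.le
  have hr : 0 < Real.sqrt (m / α) := by linarith
  have h := one_sub_poissonLT_sq_le (m := m) (u := Real.sqrt α * d)
    (v := Real.sqrt α * Real.sqrt (m / α)) (by positivity) (by positivity)
    (by gcongr; linarith) (by
      rw [mul_pow, hsq, Real.sq_sqrt (by positivity), mul_div_cancel₀ _ hα.ne'])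
  refine h.trans (Real.exp_le_exp.2 ?_)
  rw [← mul_sub, mul_pow, hsq]
  have : C ^ 2 ≤ (d - Real.sqrt (m / α)) ^ 2 := by
    rw [← neg_sub, neg_sq]
    exact pow_le_pow_left₀ hC.le (by linarith) 2
  have := mul_le_mul_of_nonneg_left this hα.le
  linarith

/-- One of the four steps of length `t` along the axes approaches a given far point. -/
theorem exists_step_closer (z l : ℂ) {t : ℝ} (ht : 0 < t) (h : 2 * t ≤ ‖z - l‖) :
    ∃ s ∈ ({1, -1, Complex.I, -Complex.I} : Finset ℂ), ‖z + t * s - l‖ ≤ ‖z - l‖ - t / 4 := by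
  set d := ‖z - l‖ with hd
  have hsq : d ^ 2 = (z - l).re ^ 2 + (z - l).im ^ 2 := by
    rw [hd, Complex.sq_norm, Complex.normSq_apply]
    ring
  -- The constant 7/10 is below 1/√2, and the larger coordinate of z - l has modulus at least d/√2.
  have key : ∀ s : ℂ, s.re ^ 2 + s.im ^ 2 = 1 →
      (z - l).re * s.re + (z - l).im * s.im ≤ -(7 / 10 * d) →
      ‖z + t * s - l‖ ≤ d - t / 4 := by
    intro s hs hle
    refine le_of_sq_le_sq ?_ (by linarith)
    have : ‖z + t * s - l‖ ^ 2 = d ^ 2 + 2 * t * ((z - l).re * s.re + (z - l).im * s.im)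
        + t ^ 2 * (s.re ^ 2 + s.im ^ 2) := by
      rw [hsq, Complex.sq_norm, Complex.normSq_apply]
      simp
      ring
    rw [this, hs]
    nlinarith
  have hd0 : 0 ≤ d := norm_nonneg _
  rcases le_total ((z - l).im ^ 2) ((z - l).re ^ 2) with hc | hc
  · have h7 : 7 / 10 * d ≤ |(z - l).re| := le_of_sq_le_sq (by rw [sq_abs]; nlinarith) (abs_nonneg _)
    rcases le_total 0 (z - l).re with hx | hx
    · rw [abs_of_nonneg hx] at h7
      exact ⟨-1, by simp, key _ (by simp) (by simp at h7 ⊢; linarith)⟩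
    · rw [abs_of_nonpos hx] at h7
      exact ⟨1, by simp, key _ (by simp) (by simp at h7 ⊢; linarith)⟩
  · have h7 : 7 / 10 * d ≤ |(z - l).im| := le_of_sq_le_sq (by rw [sq_abs]; nlinarith) (abs_nonneg _)
    rcases le_total 0 (z - l).im with hx | hx
    · rw [abs_of_nonneg hx] at h7
      exact ⟨-Complex.I, by simp, key _ (by simp) (by simp at h7 ⊢; linarith)⟩
    · rw [abs_of_nonpos hx] at h7
      exact ⟨Complex.I, by simp, key _ (by simp) (by simp at h7 ⊢; linarith)⟩

theorem exists_exp_neg_mul_sq_lt {β ε : ℝ} (hβ : 0 < β) (hε : 0 < ε) :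
    ∃ t : ℝ, 0 < t ∧ Real.exp (-(β * t ^ 2)) < ε := by
  have h : Filter.Tendsto (fun t : ℝ => Real.exp (-(β * t ^ 2))) Filter.atTop (nhds 0) :=
    Real.tendsto_exp_neg_atTop_nhds_zero.comp
      ((Filter.tendsto_pow_atTop two_ne_zero).const_mul_atTop hβ)
  obtain ⟨t, ht, ht'⟩ := ((h.eventually_lt_const hε).and (Filter.eventually_gt_atTop 0)).exists
  exact ⟨t, ht', ht⟩

theorem IsSampling.exists_cover {ι : Type*} {α : ℝ} (hα : 0 < α) {pt : ι → ℂ} {m : ι → ℕ}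
    (h : IsSampling α pt m) :
    ∃ C : ℝ, 0 < C ∧ ∀ z : ℂ, ∃ i, ‖z - pt i‖ ≤ Real.sqrt (m i / α) + C := by
  obtain ⟨A, B, hA, hB, hAB⟩ := h
  set F : ℂ → ι → ℝ := fun w i => poissonLT (m i) ((Real.sqrt α * ‖w - pt i‖) ^ 2) with hF
  have hF0 : ∀ w i, 0 ≤ F w i := fun w i => Finset.sum_nonneg fun k _ => by positivity
  have hFs : ∀ w, Summable (F w) ∧ A ≤ ∑' i, F w i ∧ ∑' i, F w i ≤ B := by
    intro w
    have := hAB _ (translate_mem_space w (basisFun_mem_space hα 0))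
    simpa only [sum_norm_innerProd_translate_sq hα, normSq_translate_basisFun_zero hα, mul_one]
      using this
  -- A step brings z closer by t/4, whence α/16; the four possible steps cost the factor 4B.
  obtain ⟨t, ht, htε⟩ := exists_exp_neg_mul_sq_lt (β := α / 16) (ε := A / (4 * B)) (by positivity)
    (by positivity)
  refine ⟨2 * t, by positivity, ?_⟩
  by_contra! hcon
  obtain ⟨z, hz⟩ := hcon
  set S : Finset ℂ := {1, -1, Complex.I, -Complex.I} with hS
  set ε := Real.exp (-(α / 16 * t ^ 2)) with hε
  -- The useful step depends on i; bounding by all four allows summation over i. The margin 2t keeps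
  -- the moved point outside the disc, where the Gaussian decay applies.
  have hle : ∀ i, F z i ≤ ε * ∑ s ∈ S, F (z + t * s) i := by
    intro i
    have hr := Real.sqrt_nonneg (m i / α)
    obtain ⟨s, hs, hsle⟩ := exists_step_closer z (pt i) ht (by linarith [hz i])
    have hge : ‖z - pt i‖ - t ≤ ‖z + t * s - pt i‖ := by
      have hsn : ‖(t : ℂ) * s‖ = t := by
        rw [norm_mul, Complex.norm_real, Real.norm_of_nonneg ht.le]
        simp only [Finset.mem_insert, Finset.mem_singleton] at hs
        rcases hs with rfl | rfl | rfl | rfl <;> simp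
      have := norm_sub_le (z + t * s - pt i) (t * s)
      rw [hsn, show z + t * s - pt i - t * s = z - pt i by ring] at this
      linarith
    have h1 := poissonLT_scaled_le hα (m := m i) (d := ‖z - pt i‖) (d' := ‖z + t * s - pt i‖)
      (by linarith [hz i]) (by linarith) (by linarith [hz i])
    refine h1.trans ?_
    have h2 : F (z + t * s) i ≤ ∑ s ∈ S, F (z + t * s) i :=
      Finset.single_le_sum (f := fun s => F (z + t * s) i) (fun s _ => hF0 _ i) hs
    refine mul_le_mul (Real.exp_le_exp.2 ?_) h2 (hF0 _ i) (Real.exp_pos _).le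
    have : (t / 4) ^ 2 ≤ (‖z - pt i‖ - ‖z + t * s - pt i‖) ^ 2 :=
      pow_le_pow_left₀ (by positivity) (by linarith) 2
    have := mul_le_mul_of_nonneg_left this hα.le
    linarith
  have hsum := (summable_sum fun s (_ : s ∈ S) => (hFs (z + t * s)).1).mul_left ε
  have h1 := (hFs z).1.tsum_le_tsum hle hsum
  rw [tsum_mul_left, Summable.tsum_finsetSum fun s _ => (hFs (z + t * s)).1] at h1
  have h2 : ∑ s ∈ S, ∑' i, F (z + t * s) i ≤ 4 * B := by
    calc _ ≤ ∑ s ∈ S, B := Finset.sum_le_sum fun s _ => (hFs (z + t * s)).2.2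
      _ = S.card * B := by rw [Finset.sum_const, nsmul_eq_mul]
      _ ≤ 4 * B := by
        gcongr
        exact_mod_cast Finset.card_le_four
  have h3 : ε * (4 * B) < A := by
    rwa [lt_div_iff₀ (by positivity)] at htε
  have h4 := mul_le_mul_of_nonneg_left h2 (Real.exp_pos (-(α / 16 * t ^ 2))).le
  linarith [(hFs z).2.1]

theorem IsSampling.exists_separation {ι : Type*} {α : ℝ} (hα : 0 < α) {pt : ι → ℂ} {m : ι → ℕ}
    (h : IsSampling α pt m) (hI : IsInterpolating α pt m) :
    ∃ C : ℝ, 0 < C ∧ ∀ i j, i ≠ j → ∀ w : ℂ, ‖w - pt i‖ ≤ Real.sqrt (m i / α) - C →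
      ‖w - pt j‖ ≤ Real.sqrt (m j / α) - C → False := by
  classical
  obtain ⟨A, B, hA, hB, hAB⟩ := h
  -- The bound 1/2 gives s > 1/2 below, and A/16 makes both errors less than 1/4.
  obtain ⟨C, hC, hCε⟩ := exists_exp_neg_mul_sq_lt hα (ε := min (1 / 2) (A / 16)) (by positivity)
  obtain ⟨hε1, hε2⟩ := lt_min_iff.1 hCε
  set ε := Real.exp (-(α * C ^ 2)) with hε
  refine ⟨C, hC, fun i j hij w hi hj => ?_⟩
  have hf := translate_mem_space w (basisFun_mem_space hα 0)
  set f := translate α w (basisFun α 0) with hfdef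
  -- The interpolant g copies f at i and vanishes at all other nodes. As f is nearly spanned by
  -- either block, its pairing with g would be near s by block i and near 0 by block j.
  set v : ι → ℕ → ℂ := fun i' k =>
    if i' = i then innerProd α f (translate α (pt i) (basisFun α k)) else 0 with hv
  have hvs : ∀ i' ≠ i, ∑ k ∈ Finset.range (m i'), ‖v i' k‖ ^ 2 = 0 := fun i' hi' => by
    simp [hv, hi']
  obtain ⟨g, hg, hgv⟩ := hI v (summable_of_ne_finset_zero (s := {i}) fun i' hi' =>
    hvs i' (by simpa using hi'))
  have hSi := one_sub_poissonLT_scaled_le hα (norm_nonneg _) hC hi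
  have hSj := one_sub_poissonLT_scaled_le hα (norm_nonneg _) hC hj
  -- The lower sampling bound controls g: its only nonzero block is that of f at i, of total at most
  -- 1.
  have hgnorm : normSq α g ≤ 1 / A := by
    have h1 := (hAB g hg).2.1
    have h2 : ∀ i', ∑ k ∈ Finset.range (m i'),
        ‖innerProd α g (translate α (pt i') (basisFun α k))‖ ^ 2
        = ∑ k ∈ Finset.range (m i'), ‖v i' k‖ ^ 2 := fun i' =>
      Finset.sum_congr rfl fun k hk => by rw [hgv i' k (Finset.mem_range.1 hk)]
    simp only [h2] at h1
    rw [tsum_eq_single i hvs] at h1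
    simp only [hv, if_true] at h1
    rw [sum_norm_innerProd_translate_sq hα] at h1
    rw [le_div_iff₀' hA]
    exact h1.trans (poissonLT_le_one _ (sq_nonneg _))
  have bound : ∀ l, 1 - poissonLT (m l) ((Real.sqrt α * ‖w - pt l‖) ^ 2) ≤ ε →
      ‖inner ℂ (toL2 hα hf) (toL2 hα hg) - ∑ k ∈ Finset.range (m l),
        conj (innerProd α f (translate α (pt l) (basisFun α k))) * v l k‖ ^ 2 ≤ ε / A := by
    intro l hl
    have h1 := norm_inner_sub_sum_sq_le (orthonormal_toL2_translate hα (pt l)) (toL2 hα hf)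
      (toL2 hα hg) (m l)
    simp only [inner_toL2 hα hf (translate_mem_space _ (basisFun_mem_space hα _)),
      inner_toL2 hα hg (translate_mem_space _ (basisFun_mem_space hα _))] at h1
    rw [norm_toL2_sq, norm_toL2_sq, hfdef, sum_norm_innerProd_translate_sq hα,
      normSq_translate_basisFun_zero hα, ← hfdef] at h1
    rw [Finset.sum_congr rfl fun k hk => by rw [← hgv l k (Finset.mem_range.1 hk)]]
    rw [inner_toL2 hα hg hf]
    refine h1.trans ?_
    rw [div_eq_mul_one_div]
    exact mul_le_mul hl hgnorm (by rw [← norm_toL2_sq hα hg]; positivity) (Real.exp_pos _).le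
  have hbi := bound i hSi
  have hbj := bound j hSj
  have hvj : ∀ k, v j k = 0 := fun k => if_neg hij.symm
  simp only [hvj, mul_zero, Finset.sum_const_zero, sub_zero] at hbj
  set x := inner ℂ (toL2 hα hf) (toL2 hα hg) with hx
  set s := poissonLT (m i) ((Real.sqrt α * ‖w - pt i‖) ^ 2) with hs
  have hsum : ∑ k ∈ Finset.range (m i),
      conj (innerProd α f (translate α (pt i) (basisFun α k))) * v i k = (s : ℂ) := by
    rw [hs, ← sum_norm_innerProd_translate_sq hα, Complex.ofReal_sum]
    refine Finset.sum_congr rfl fun k _ => ?_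
    simp only [hv, if_true]
    rw [norm_sq_eq, mul_comm]
  rw [hsum] at hbi
  have htri : s ≤ ‖x‖ + ‖x - s‖ := by
    have h1 := norm_sub_le x (x - s)
    rw [sub_sub_cancel, Complex.norm_real] at h1
    exact (le_abs_self _).trans h1
  have hεA : ε / A < 1 / 16 := by
    rw [div_lt_iff₀ hA]
    linarith
  have hx4 : ‖x‖ < 1 / 4 := lt_of_pow_lt_pow_left₀ 2 (by norm_num) (by norm_num; linarith)
  have hxs4 : ‖x - s‖ < 1 / 4 := lt_of_pow_lt_pow_left₀ 2 (by norm_num) (by norm_num; linarith)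
  linarith

end Fock

end

theorem corollary3 {ι : Type*} (α : ℝ) (hα : 0 < α) (pt : ι → ℂ) (m : ι → ℕ)
    (hm : Filter.Tendsto m (Filter.comap (fun i => ‖pt i‖) Filter.atTop) Filter.atTop) :
    ¬ (Fock.IsSampling α pt m ∧ Fock.IsInterpolating α pt m) := by
  rintro ⟨hS, hI⟩
  obtain ⟨C, hC, hcover⟩ := hS.exists_cover hα
  obtain ⟨D, hD, hsep⟩ := hS.exists_separation hα hI
  -- The shrunken radii are taken as ρ, so the covering excess becomes C + D.
  refine Fock.false_of_cover_of_separated (pt := pt) (ρ := fun i => Real.sqrt (m i / α) - D)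
    (c := C + D) (by positivity) (fun K => ?_) (fun z => ?_) (fun i j hij hi hj => ?_)
  · obtain ⟨M, hM⟩ := exists_nat_ge (α * (K + D) ^ 2)
    have h := Filter.eventually_comap.1 (hm.eventually_ge_atTop M)
    obtain ⟨R, hR⟩ := Filter.eventually_atTop.1 h
    refine ⟨R, fun i hi => ?_⟩
    have h1 : (M : ℝ) ≤ m i := by exact_mod_cast hR _ hi i rfl
    have h2 : K + D ≤ Real.sqrt (m i / α) := by
      refine Real.le_sqrt_of_sq_le ?_
      rw [le_div_iff₀' hα]
      exact hM.trans h1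
    linarith
  · obtain ⟨i, hi⟩ := hcover z
    exact ⟨i, by linarith⟩
  · exact Fock.add_le_norm_sub_of_disjoint hi hj (hsep i j hij)
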